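/- Let \(S=\{\frac1n,\rho_x\}_{x=1}^n\) be an equiprobable ensemble of \(n\) qubit states, with Bloch vectors \(\vec v_x\), i.e. \(\rho_x=\frac12(I+\vec v_x\cdot\vec\sigma)\). A POVM \(M=\{M_x\}_{x=1}^n\) is optimal for an ensemble \(\{q_x,\rho_x\}\) if it maximizes \(\sum_x q_x\,\mathrm{tr}(M_x\rho_x)\) over all POVMs with \(n\) outcomes; the maximum is the guessing probability \(P_g\). The discrimination problem is called nontrivial if no strategy "always guess \(\rho_j\)" (that is, \(M_x=\delta_{jx}I\)) is optimal. A channel \(\mathcal N\) (a completely positive trace preserving map) preserves an optimal measurement \(M\) of \(S\) if \(M\) is also optimal for \(S^{(\mathcal N)}=\{\frac1n,\mathcal N(\rho_x)\}_{x=1}^n\); it is OMP for \(S\) if it preserves every optimal measurement of \(S\). Let \(\delta_{\mathcal N}=P_g-P_g^{(\mathcal N)}\), where \(P_g^{(\mathcal N)}\) is the guessing probability of \(S^{(\mathcal N)}\). (1) Assume that the discrimination problem for \(S\) is nontrivial and that for each \(x\) some optimal measurement of \(S\) has \(M_x\neq0\). Let \(\mathcal N\) be a qubit channel with Bloch representation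 \((D,\vec t\,)\), i.e. \(\mathcal N(\frac12(I+\vec v\cdot\vec\sigma))=\frac12(I+(D\vec v+\vec t\,)\cdot\vec\sigma)\) with \(D\) a real \(3\times3\) matrix and \(\vec t\in\mathbb R^3\). Then the following are equivalent: - \(\mathcal N\) is OMP for \(S\) and the discrimination problem for \(S^{(\mathcal N)}\) is nontrivial; - there is \(\kappa\in(0,1]\) with \(\vec v_x-\vec v_y\in\ker(D-\kappa I)\) for all \(x,y\). The same equivalence holds when, in the first condition, "\(\mathcal N\) is OMP" is replaced by "\(\mathcal N\) preserves \(M\)", for any given optimal measurement \(M\) of \(S\) with \(M_x\ne0\) for all \(x\). Moreover \(P_g>\frac1n\), and any such \(\kappa\) equals \(1-\delta_{\mathcal N}/(P_g-\frac1n)\); in particular \(\kappa=1-n\delta_{\mathcal N}\) if \(P_g=\frac2n\). (2) For every equiprobable ensemble \(S\), every channel of the form \(\Lambda(\frac12(I+\vec v\cdot\vec\sigma))=\frac12(I+(\kappa\vec v+\vec t\,)\cdot\vec\sigma)\) with \(0<\kappa\le1\) is OMP for \(S\), and the discrimination problem for \(S^{(\Lambda)}\) is nontrivial if that for \(S\)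 is. This includes the depolarizing channels \(\rho\mapsto(1-\eta)\rho+\eta\frac I2\), \(0\le\eta<1\), which are indeed channels, with \(\kappa=1-\eta\) and \(\vec t=0\). -/

import Mathlib

open scoped Matrix ComplexOrder

/-- Operators on the qubit Hilbert space `ℂ²`. -/
abbrev QubitOp : Type := Matrix (Fin 2) (Fin 2) ℂ

/-- A quantum state: positive semidefinite (hence Hermitian) with trace one. -/
structure IsState (ρ : QubitOp) : Prop where
  posSemidef : ρ.PosSemidef
  trace_eq_one : ρ.trace = 1

/-- The Pauli matrices. -/
def pauli : Fin 3 → QubitOp :=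
  ![!![0, 1; 1, 0], !![0, -Complex.I; Complex.I, 0], !![1, 0; 0, -1]]

/-- The operator `½ (I + v · σ)` with Bloch vector `v`. -/
noncomputable def blochOp (v : Fin 3 → ℝ) : QubitOp :=
  (1 / 2 : ℂ) • (1 + ∑ i, (v i : ℂ) • pauli i)

/-- An ensemble of `n` qubit states with their a priori probabilities. -/
structure Ensemble (n : ℕ) where
  prob : Fin n → ℝ
  state : Fin n → QubitOp
  prob_nonneg : ∀ x, 0 ≤ prob x
  prob_sum : ∑ x, prob x = 1
  isState : ∀ x, IsState (state x)

/-- A measurement (POVM) with `n` outcomes; some of its elements may be zero. -/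
structure IsPOVM {n : ℕ} (M : Fin n → QubitOp) : Prop where
  posSemidef : ∀ x, (M x).PosSemidef
  sum_eq_one : ∑ x, M x = 1

/-- Complete positivity: `id_k ⊗ N` preserves positive semidefiniteness for every `k`. -/
def IsCompletelyPositive (N : QubitOp →ₗ[ℂ] QubitOp) : Prop :=
  ∀ (k : ℕ) (X : Matrix (Fin k × Fin 2) (Fin k × Fin 2) ℂ), X.PosSemidef →
    (Matrix.of fun p q : Fin k × Fin 2 =>
      N (Matrix.of fun a b => X (p.1, a) (q.1, b)) p.2 q.2).PosSemidef

/-- A qubit channel: a completely positive, trace preserving linear map. -/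
structure IsChannel (N : QubitOp →ₗ[ℂ] QubitOp) : Prop where
  completelyPositive : IsCompletelyPositive N
  tracePreserving : ∀ X, (N X).trace = X.trace

theorem IsChannel.map_isState {N : QubitOp →ₗ[ℂ] QubitOp} (hN : IsChannel N)
    {ρ : QubitOp} (hρ : IsState ρ) : IsState (N ρ) := by
  refine ⟨?_, by rw [hN.tracePreserving, hρ.trace_eq_one]⟩
  have h := hN.completelyPositive 1 (ρ.submatrix Prod.snd Prod.snd)
    (hρ.posSemidef.submatrix _)
  exact h.submatrix (fun a : Fin 2 => ((0 : Fin 1), a))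

/-- `N` acts on Bloch vectors as `v ↦ D v + t`. -/
def HasBlochRep (N : QubitOp →ₗ[ℂ] QubitOp) (D : Matrix (Fin 3) (Fin 3) ℝ)
    (t : Fin 3 → ℝ) : Prop :=
  ∀ v : Fin 3 → ℝ, v ⬝ᵥ v ≤ 1 → N (blochOp v) = blochOp (D *ᵥ v + t)

/-- The depolarizing map, `ρ ↦ (1 - η) ρ + η I / 2` on states. -/
noncomputable def depolarizing (η : ℝ) : QubitOp →ₗ[ℂ] QubitOp :=
  ((1 - η : ℝ) : ℂ) • LinearMap.id +
    ((η / 2 : ℝ) : ℂ) • (Matrix.traceLinearMap (Fin 2) ℂ ℂ).smulRight (1 : QubitOp)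

namespace Ensemble

variable {n : ℕ}

/-- The ensemble of the states after the use of a channel. -/
def map (S : Ensemble n) (N : QubitOp →ₗ[ℂ] QubitOp) (hN : IsChannel N) : Ensemble n where
  prob := S.prob
  state x := N (S.state x)
  prob_nonneg := S.prob_nonneg
  prob_sum := S.prob_sum
  isState x := hN.map_isState (S.isState x)

/-- The average probability of a correct guess with the measurement `M`. -/
noncomputable def successProb (S : Ensemble n) (M : Fin n → QubitOp) : ℝ :=
  ∑ x, S.prob x * ((M x * S.state x).trace).re

/-- `M` solves the minimum error discrimination problem for `S`. -/
def IsOptimal (S : Ensemble n) (M : Fin n → QubitOp) : Prop :=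
  IsPOVM M ∧ ∀ M' : Fin n → QubitOp, IsPOVM M' → S.successProb M' ≤ S.successProb M

/-- The guessing probability: the optimal success probability over all POVMs. -/
noncomputable def guessProb (S : Ensemble n) : ℝ :=
  sSup {p : ℝ | ∃ M : Fin n → QubitOp, IsPOVM M ∧ p = S.successProb M}

/-- The measurement-free strategy that always guesses `j` (the POVM with `M_j = I`). -/
def alwaysGuess (j : Fin n) : Fin n → QubitOp := fun x => if x = j then 1 else 0

/-- Discrimination is nontrivial: no strategy that always guesses the same state is optimal. -/
def IsNontrivial (S : Ensemble n) : Prop := ∀ j : Fin n, ¬ S.IsOptimal (alwaysGuess j)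

/-- Every state of the ensemble is identified by some optimal measurement. -/
def AllIdentified (S : Ensemble n) : Prop :=
  ∀ x, ∃ M : Fin n → QubitOp, S.IsOptimal M ∧ M x ≠ 0

/-- All a priori probabilities are equal. -/
def Equiprobable (S : Ensemble n) : Prop := ∀ x, S.prob x = 1 / (n : ℝ)

/-- The guessing degradation `P_g - P_g^(N)`. -/
noncomputable def degradation (S : Ensemble n) (N : QubitOp →ₗ[ℂ] QubitOp)
    (hN : IsChannel N) : ℝ :=
  S.guessProb - (S.map N hN).guessProb

/-- The measurement `M` is optimal for the ensemble both before and after the channel use. -/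
def Preserves (S : Ensemble n) (N : QubitOp →ₗ[ℂ] QubitOp) (hN : IsChannel N)
    (M : Fin n → QubitOp) : Prop :=
  S.IsOptimal M ∧ (S.map N hN).IsOptimal M

/-- The channel is (strongly) optimal measurement preserving: every measurement that solves the
discrimination problem for `S` also solves it after the channel use. -/
def IsOMP (S : Ensemble n) (N : QubitOp →ₗ[ℂ] QubitOp) (hN : IsChannel N) : Prop :=
  ∀ M : Fin n → QubitOp, S.IsOptimal M → S.Preserves N hN M

end Ensemble

/-- `κ ∈ (0, 1]` and all differences of the Bloch vectors `v x` lie in `ker (D - κ I)`. -/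
def KernelCondition {n : ℕ} (D : Matrix (Fin 3) (Fin 3) ℝ) (v : Fin n → Fin 3 → ℝ)
    (κ : ℝ) : Prop :=
  κ ∈ Set.Ioc (0 : ℝ) 1 ∧
    ∀ x y, v x - v y ∈ LinearMap.ker (Matrix.toLin' (D - κ • (1 : Matrix (Fin 3) (Fin 3) ℝ)))

/-! Write POVM elements as `a x` I + `b x` · σ with ‖`b x`‖ ≤ `a x`, ∑ `a x` = 1, ∑ `b x` = 0. With
equal priors the success probability is (1 + ∑ ⟪`b x`, `v x`⟫) / n, so one maximizes a linear
functional, and nontriviality says that its maximum F is positive. At an optimum with all elements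
nonzero, stationarity gives `v x` - `v y` = F (u_x - u_y) with u_x = `b x` / ‖`b x`‖
(`IsOptimal.exists_sub_eq_smul`). If the same measurement is optimal after a channel, with maximum G
> 0, then D (`v x` - `v y`) = G (u_x - u_y) with the same directions, whence κ = G / F; κ ≤ 1
because channels map the Bloch ball into itself. Conversely, under the kernel condition D `v x` + t
is κ `v x` plus a constant vector, which ∑ `b x` = 0 removes: the success probability becomes an
increasing affine function of the old one (`successProb_map_of_kernelCondition`), with the same
maximizers. This also yields the value of κ. -/

/-- Bloch vectors with their Euclidean norm. -/
abbrev BlochSpace : Type := EuclideanSpace ℝ (Fin 3)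

/-! ### Qubit operators in Bloch coordinates -/

/-- The Hermitian operator `a I + b · σ`. -/
noncomputable def hermOp (a : ℝ) (b : BlochSpace) : QubitOp :=
  (a : ℂ) • 1 + ∑ i, (b i : ℂ) • pauli i

theorem hermOp_eq (a : ℝ) (b : BlochSpace) :
    hermOp a b = !![(a + b 2 : ℂ), b 0 - b 1 * Complex.I; b 0 + b 1 * Complex.I, a - b 2] := by
  ext i j
  fin_cases i <;> fin_cases j <;> simp [hermOp, pauli, Fin.sum_univ_three] <;> ring

theorem blochOp_eq_hermOp (v : Fin 3 → ℝ) :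
    blochOp v = hermOp (1 / 2) ((1 / 2 : ℝ) • WithLp.toLp 2 v) := by
  simp only [blochOp, hermOp, smul_add, Finset.smul_sum, smul_smul, PiLp.smul_apply, smul_eq_mul,
    Complex.ofReal_mul]
  norm_num

theorem hermOp_add (a a' : ℝ) (b b' : BlochSpace) :
    hermOp a b + hermOp a' b' = hermOp (a + a') (b + b') := by
  simp only [hermOp, PiLp.add_apply, Complex.ofReal_add, add_smul, Finset.sum_add_distrib]
  abel

theorem hermOp_zero : hermOp 0 0 = 0 := by simp [hermOp]

theorem hermOp_sum {ι : Type*} (s : Finset ι) (a : ι → ℝ) (b : ι → BlochSpace) :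
    ∑ x ∈ s, hermOp (a x) (b x) = hermOp (∑ x ∈ s, a x) (∑ x ∈ s, b x) := by
  classical
  induction s using Finset.induction_on with
  | empty => simp [hermOp_zero]
  | insert x s hx ih => rw [Finset.sum_insert hx, Finset.sum_insert hx, Finset.sum_insert hx, ih,
      hermOp_add]

theorem hermOp_injective {a a' : ℝ} {b b' : BlochSpace} (h : hermOp a b = hermOp a' b') :
    a = a' ∧ b = b' := by
  rw [hermOp_eq, hermOp_eq] at h
  have h00 := congrArg Complex.re (congrFun (congrFun h 0) 0)
  have h11 := congrArg Complex.re (congrFun (congrFun h 1) 1)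
  have h10 := congrArg Complex.re (congrFun (congrFun h 1) 0)
  have h10' := congrArg Complex.im (congrFun (congrFun h 1) 0)
  simp at h00 h11 h10 h10'
  refine ⟨by linarith, ?_⟩
  ext i
  fin_cases i <;> simp <;> linarith

theorem hermOp_one : hermOp 1 0 = 1 := by simp [hermOp]

theorem norm_sq_blochSpace (b : BlochSpace) : ‖b‖ ^ 2 = b 0 ^ 2 + b 1 ^ 2 + b 2 ^ 2 := by
  rw [EuclideanSpace.real_norm_sq_eq, Fin.sum_univ_three]

/-- For a = ‖b‖ the operator H satisfies Hᴴ H = 2‖b‖ H, so it is a nonnegative multiple of a Gram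
matrix; the excess a - ‖b‖ only adds a multiple of I. -/
theorem hermOp_posSemidef {a : ℝ} {b : BlochSpace} (h : ‖b‖ ≤ a) : (hermOp a b).PosSemidef := by
  have hsq : (hermOp ‖b‖ b)ᴴ * hermOp ‖b‖ b = ((2 * ‖b‖ : ℝ) : ℂ) • hermOp ‖b‖ b := by
    have hb : (‖b‖ : ℂ) ^ 2 = b 0 ^ 2 + b 1 ^ 2 + b 2 ^ 2 := by
      exact_mod_cast norm_sq_blochSpace b
    rw [hermOp_eq]
    ext i j
    fin_cases i <;> fin_cases j <;> simp [Matrix.mul_apply, Fin.sum_univ_two] <;>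
      ring_nf <;> simp only [Complex.I_sq] <;> linear_combination -hb
  have hpos : (hermOp ‖b‖ b).PosSemidef := by
    rcases (norm_nonneg b).eq_or_lt with h0 | h0
    · rw [← h0, norm_eq_zero.mp h0.symm, hermOp_zero]
      exact Matrix.PosSemidef.zero
    · have : hermOp ‖b‖ b = (((2 * ‖b‖)⁻¹ : ℝ) : ℂ) • ((hermOp ‖b‖ b)ᴴ * hermOp ‖b‖ b) := by
        rw [hsq, smul_smul, ← Complex.ofReal_mul, inv_mul_cancel₀ (by positivity)]
        simp
      rw [this]
      exact (Matrix.posSemidef_conjTranspose_mul_self _).smul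
        (Complex.zero_le_real.mpr (by positivity))
  have hsplit : hermOp a b = ((a - ‖b‖ : ℝ) : ℂ) • (1 : QubitOp) + hermOp ‖b‖ b := by
    simp only [hermOp, Complex.ofReal_sub, sub_smul]
    abel
  rw [hsplit]
  exact (Matrix.PosSemidef.one.smul (Complex.zero_le_real.mpr (sub_nonneg.mpr h))).add hpos

theorem exists_hermOp_of_posSemidef {A : QubitOp} (hA : A.PosSemidef) :
    ∃ (a : ℝ) (b : BlochSpace), A = hermOp a b ∧ ‖b‖ ≤ a := by
  have h01 : A 0 1 = star (A 1 0) := (hA.isHermitian.apply 0 1).symm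
  have h00 := hA.diag_nonneg (i := 0)
  have h11 := hA.diag_nonneg (i := 1)
  have hdet := hA.det_nonneg
  rw [Matrix.det_fin_two, h01] at hdet
  rw [Complex.nonneg_iff] at h00 h11 hdet
  obtain ⟨h00, h00i⟩ := h00
  obtain ⟨h11, h11i⟩ := h11
  have hd := hdet.1
  simp [← h00i, ← h11i] at hd
  refine ⟨((A 0 0).re + (A 1 1).re) / 2,
    !₂[(A 1 0).re, (A 1 0).im, ((A 0 0).re - (A 1 1).re) / 2], ?_, ?_⟩
  · rw [hermOp_eq]
    ext i j
    fin_cases i <;> fin_cases j <;> apply Complex.ext <;> simp [h01, ← h00i, ← h11i] <;> ring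
  · refine abs_le_of_sq_le_sq' ?_ (by positivity) |>.2
    rw [norm_sq_blochSpace]
    simp
    nlinarith

theorem trace_hermOp_mul_blochOp (a : ℝ) (b : BlochSpace) (v : Fin 3 → ℝ) :
    ((hermOp a b * blochOp v).trace).re = a + inner ℝ b (WithLp.toLp 2 v) := by
  rw [blochOp_eq_hermOp, hermOp_eq, hermOp_eq, PiLp.inner_apply]
  simp [Matrix.trace_fin_two, Fin.sum_univ_three]
  ring

theorem IsState.exists_blochOp {ρ : QubitOp} (h : IsState ρ) :
    ∃ v : Fin 3 → ℝ, ρ = blochOp v ∧ v ⬝ᵥ v ≤ 1 := by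
  obtain ⟨a, b, rfl, hab⟩ := exists_hermOp_of_posSemidef h.posSemidef
  have ha : a = 1 / 2 := by
    have := congrArg Complex.re h.trace_eq_one
    simp [hermOp_eq, Matrix.trace_fin_two] at this
    linarith
  subst ha
  refine ⟨fun i => 2 * b i, ?_, ?_⟩
  · rw [blochOp_eq_hermOp]
    congr 1
    ext i
    simp
  · have := norm_sq_blochSpace b
    simp [dotProduct, Fin.sum_univ_three]
    nlinarith [norm_nonneg b]

theorem blochOp_injective {v w : Fin 3 → ℝ} (h : blochOp v = blochOp w) : v = w := by
  rw [blochOp_eq_hermOp, blochOp_eq_hermOp] at h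
  have := (hermOp_injective h).2
  ext i
  simpa using congrArg (fun b : BlochSpace => b i) this

theorem blochOp_isState_iff {v : Fin 3 → ℝ} : IsState (blochOp v) ↔ v ⬝ᵥ v ≤ 1 := by
  refine ⟨fun h => ?_, fun h => ⟨?_, ?_⟩⟩
  · obtain ⟨w, hw, hw1⟩ := h.exists_blochOp
    rwa [blochOp_injective hw]
  · rw [blochOp_eq_hermOp]
    apply hermOp_posSemidef
    refine abs_le_of_sq_le_sq' ?_ (by positivity) |>.2
    rw [norm_sq_blochSpace]
    simp [dotProduct, Fin.sum_univ_three] at h ⊢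
    linarith
  · rw [blochOp_eq_hermOp]
    simp [hermOp_eq, Matrix.trace_fin_two]
    norm_num

/-! ### First-order variation of sums of norms -/

section Perturbation

variable {E : Type*} [NormedAddCommGroup E] [InnerProductSpace ℝ E]

/-- Comes from 2‖b‖s ≤ s² + ‖b‖² at s = ‖b + εd‖; the explicit quadratic remainder replaces
differentiability of the norm. -/
theorem norm_add_smul_le {b : E} (hb : b ≠ 0) (d : E) (ε : ℝ) :
    ‖b + ε • d‖ ≤ ‖b‖ + ε * inner ℝ (‖b‖⁻¹ • b) d + ε ^ 2 * (‖d‖ ^ 2 / (2 * ‖b‖)) := by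
  have hb' : 0 < ‖b‖ := norm_pos_iff.mpr hb
  have hsq : ‖b + ε • d‖ ^ 2 = ‖b‖ ^ 2 + 2 * (ε * inner ℝ b d) + ε ^ 2 * ‖d‖ ^ 2 := by
    rw [norm_add_sq_real, inner_smul_right, norm_smul, mul_pow, Real.norm_eq_abs, sq_abs]
  have key : ‖b + ε • d‖ * (2 * ‖b‖) ≤ 2 * ‖b‖ ^ 2 + 2 * (ε * inner ℝ b d) + ε ^ 2 * ‖d‖ ^ 2 := by
    nlinarith [sq_nonneg (‖b + ε • d‖ - ‖b‖)]
  rw [← le_div_iff₀ (by positivity)] at key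
  refine key.trans_eq ?_
  rw [real_inner_smul_left]
  field_simp

/-- Stationarity for the maximization of `∑ ⟪b x, v x⟫` at fixed `∑ ‖b x‖` and `∑ b x = 0`. -/
theorem sub_eq_smul_of_isMax {ι : Type*} [Fintype ι] {v b : ι → E} {F : ℝ}
    (hmax : ∀ b' : ι → E, ∑ x, b' x = 0 → ∑ x, inner ℝ (b' x) (v x) ≤ F * ∑ x, ‖b' x‖)
    (hF : 0 ≤ F) (hb : ∑ x, b x = 0) (heq : ∑ x, inner ℝ (b x) (v x) = F * ∑ x, ‖b x‖)
    (hne : ∀ x, b x ≠ 0) (x y : ι) :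
    v x - v y = F • (‖b x‖⁻¹ • b x - ‖b y‖⁻¹ • b y) := by
  classical
  rcases eq_or_ne x y with rfl | hxy
  · simp
  -- The defect d is itself the test direction: moving `b x` by εd and `b y` by -εd keeps the sum
  -- zero and gains ε‖d‖² to first order, against a loss of at most ε²C.
  set d := v x - v y - F • (‖b x‖⁻¹ • b x - ‖b y‖⁻¹ • b y) with hd
  set C := F * (‖d‖ ^ 2 / (2 * ‖b x‖) + ‖d‖ ^ 2 / (2 * ‖b y‖)) with hC
  have hsum : ∀ f : ι → ℝ, ∀ g : ι → ℝ, (∀ z, z ≠ x → z ≠ y → f z = g z) →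
      ∑ z, f z - ∑ z, g z = (f x - g x) + (f y - g y) := by
    intro f g h
    rw [← Finset.sum_sub_distrib]
    exact Fintype.sum_eq_add x y hxy (fun z hz => by rw [h z hz.1 hz.2, sub_self])
  have hε : ∀ ε : ℝ, 0 < ε → ‖d‖ ^ 2 ≤ ε * C := by
    intro ε hε0
    let b' : ι → E := fun z => b z + ((if z = x then ε else 0) • d + (if z = y then -ε else 0) • d)
    have hb'x : b' x = b x + ε • d := by simp [b', hxy]
    have hb'y : b' y = b y + (-ε) • d := by simp [b', hxy.symm]
    have hb'z : ∀ z, z ≠ x → z ≠ y → b' z = b z := fun z h1 h2 => by simp [b', h1, h2]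
    have h0 : ∑ z, b' z = 0 := by
      simp [b', Finset.sum_add_distrib, hb]
    have h1 := hmax b' h0
    have h2 := hsum (fun z => inner ℝ (b' z) (v z)) (fun z => inner ℝ (b z) (v z))
      (fun z hx hy => by simp only [hb'z z hx hy])
    have h3 := hsum (fun z => ‖b' z‖) (fun z => ‖b z‖)
      (fun z hx hy => by simp only [hb'z z hx hy])
    simp only [hb'x, hb'y, inner_add_left, real_inner_smul_left] at h2 h3
    have h4 := norm_add_smul_le (hne x) d ε
    have h5 := norm_add_smul_le (hne y) d (-ε)
    have h6 : ‖d‖ ^ 2 = inner ℝ d (v x) - inner ℝ d (v y) -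
        F * (inner ℝ (‖b x‖⁻¹ • b x) d - inner ℝ (‖b y‖⁻¹ • b y) d) := by
      rw [← real_inner_self_eq_norm_sq]
      nth_rewrite 2 [hd]
      rw [inner_sub_right, inner_sub_right, real_inner_smul_right, inner_sub_right,
        real_inner_comm d (‖b x‖⁻¹ • b x), real_inner_comm d (‖b y‖⁻¹ • b y)]
    have h7 : F * (∑ z, ‖b' z‖ - ∑ z, ‖b z‖) ≤
        F * (ε * (inner ℝ (‖b x‖⁻¹ • b x) d - inner ℝ (‖b y‖⁻¹ • b y) d) +
          ε ^ 2 * (‖d‖ ^ 2 / (2 * ‖b x‖) + ‖d‖ ^ 2 / (2 * ‖b y‖))) := by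
      apply mul_le_mul_of_nonneg_left _ hF
      linarith
    have h8 : ε * ‖d‖ ^ 2 ≤ ε * (ε * C) := by
      rw [h6, hC]
      linarith
    exact le_of_mul_le_mul_left h8 hε0
  have hd0 : ‖d‖ ^ 2 ≤ 0 := by
    have hlim : Filter.Tendsto (fun ε : ℝ => ε * C) (nhdsWithin 0 (Set.Ioi 0)) (nhds 0) := by
      have : Filter.Tendsto (fun ε : ℝ => ε * C) (nhds 0) (nhds (0 * C)) :=
        (continuous_id.mul continuous_const).tendsto 0
      rw [zero_mul] at this
      exact this.mono_left nhdsWithin_le_nhds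
    exact ge_of_tendsto hlim (Filter.eventually_of_mem self_mem_nhdsWithin hε)
  have : d = 0 := norm_eq_zero.mp (pow_eq_zero_iff two_ne_zero |>.mp (le_antisymm hd0 (sq_nonneg _)))
  rw [hd] at this
  exact sub_eq_zero.mp this

end Perturbation

/-! ### Optimal measurements of equiprobable ensembles -/

theorem isPOVM_alwaysGuess {n : ℕ} (j : Fin n) : IsPOVM (Ensemble.alwaysGuess j) where
  posSemidef x := by
    unfold Ensemble.alwaysGuess
    split_ifs
    exacts [Matrix.PosSemidef.one, Matrix.PosSemidef.zero]
  sum_eq_one := by simp [Ensemble.alwaysGuess]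

theorem IsPOVM.exists_hermOp {n : ℕ} {M : Fin n → QubitOp} (hM : IsPOVM M) :
    ∃ (a : Fin n → ℝ) (b : Fin n → BlochSpace), (∀ x, M x = hermOp (a x) (b x)) ∧
      (∀ x, ‖b x‖ ≤ a x) ∧ ∑ x, a x = 1 ∧ ∑ x, b x = 0 := by
  choose a b hab hle using fun x => exists_hermOp_of_posSemidef (hM.posSemidef x)
  have h := hM.sum_eq_one
  simp only [hab] at h
  rw [hermOp_sum, ← hermOp_one] at h
  exact ⟨a, b, hab, hle, hermOp_injective h⟩

theorem isPOVM_hermOp {n : ℕ} {a : Fin n → ℝ} {b : Fin n → BlochSpace}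
    (hle : ∀ x, ‖b x‖ ≤ a x) (ha : ∑ x, a x = 1) (hb : ∑ x, b x = 0) :
    IsPOVM fun x => hermOp (a x) (b x) where
  posSemidef x := hermOp_posSemidef (hle x)
  sum_eq_one := by rw [hermOp_sum, ha, hb, hermOp_one]

namespace Ensemble

variable {n : ℕ} {S : Ensemble n}

theorem pos_card (S : Ensemble n) : 0 < n := by
  rcases Nat.eq_zero_or_pos n with rfl | h
  · simpa using S.prob_sum
  · exact h

theorem successProb_hermOp (hS : S.Equiprobable) {v : Fin n → Fin 3 → ℝ}
    (hv : ∀ x, S.state x = blochOp (v x)) {a : Fin n → ℝ} {b : Fin n → BlochSpace}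
    (ha : ∑ x, a x = 1) :
    S.successProb (fun x => hermOp (a x) (b x)) =
      1 / n * (1 + ∑ x, inner ℝ (b x) (WithLp.toLp 2 (v x))) := by
  unfold successProb
  simp only [hS _, hv, trace_hermOp_mul_blochOp]
  rw [← Finset.mul_sum, Finset.sum_add_distrib, ha]

theorem exists_blochOp (S : Ensemble n) :
    ∃ v : Fin n → Fin 3 → ℝ, ∀ x, S.state x = blochOp (v x) := by
  choose v hv _ using fun x => (S.isState x).exists_blochOp
  exact ⟨v, hv⟩

theorem successProb_alwaysGuess (hS : S.Equiprobable) (j : Fin n) :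
    S.successProb (alwaysGuess j) = 1 / n := by
  rw [successProb, Finset.sum_eq_single j]
  · simp [alwaysGuess, hS j, (S.isState j).trace_eq_one]
  · intro x _ hx
    simp [alwaysGuess, hx]
  · simp

theorem IsOptimal.guessProb_eq {M : Fin n → QubitOp} (hM : S.IsOptimal M) :
    S.guessProb = S.successProb M := by
  refine IsGreatest.csSup_eq ⟨⟨M, hM.1, rfl⟩, ?_⟩
  rintro p ⟨M', hM', rfl⟩
  exact hM.2 M' hM'

theorem IsNontrivial.one_div_lt_successProb (hS : S.Equiprobable) (hnt : S.IsNontrivial)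
    {M : Fin n → QubitOp} (hM : S.IsOptimal M) : 1 / (n : ℝ) < S.successProb M := by
  let j : Fin n := ⟨0, S.pos_card⟩
  by_contra! h
  refine hnt j ⟨isPOVM_alwaysGuess j, fun M' hM' => (hM.2 M' hM').trans ?_⟩
  rwa [successProb_alwaysGuess hS]

/-- If every state is identified by some optimal measurement, then a single optimal measurement
identifies all of them. -/
theorem AllIdentified.exists_isOptimal (h : S.AllIdentified) :
    ∃ M : Fin n → QubitOp, S.IsOptimal M ∧ ∀ x, M x ≠ 0 := by
  choose M hM hne using h
  have hn : (0 : ℝ) < n := Nat.cast_pos.mpr S.pos_card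
  have hnC : (n : ℂ) ≠ 0 := by exact_mod_cast S.pos_card.ne'
  -- The average of optimal measurements is optimal, and positive semidefinite terms cannot cancel.
  let A : Fin n → QubitOp := fun x => ((n : ℝ)⁻¹ : ℂ) • ∑ y, M y x
  have hinv : (0 : ℂ) ≤ ((n : ℝ)⁻¹ : ℂ) := by
    rw [← Complex.ofReal_inv]
    exact Complex.zero_le_real.mpr (by positivity)
  have hA : IsPOVM A := by
    refine ⟨fun x => (Matrix.posSemidef_sum _ fun y _ => (hM y).1.posSemidef x).smul hinv, ?_⟩
    simp only [A]
    rw [← Finset.smul_sum, Finset.sum_comm]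
    simp only [(hM _).1.sum_eq_one]
    rw [Finset.sum_const, Finset.card_univ, Fintype.card_fin, ← Nat.cast_smul_eq_nsmul ℂ,
      smul_smul]
    simp [hnC]
  have hsucc : S.successProb A = (n : ℝ)⁻¹ * ∑ y, S.successProb (M y) := by
    unfold successProb
    rw [Finset.sum_comm, Finset.mul_sum]
    refine Finset.sum_congr rfl fun x _ => ?_
    have : ((A x * S.state x).trace).re = (n : ℝ)⁻¹ * ∑ y, ((M y x * S.state x).trace).re := by
      simp only [A, ← Complex.ofReal_inv]
      rw [Matrix.smul_mul, Matrix.trace_smul, smul_eq_mul, Complex.re_ofReal_mul,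
        Finset.sum_mul, Matrix.trace_sum, Complex.re_sum]
    rw [this, ← Finset.mul_sum]
    ring
  refine ⟨A, ⟨hA, fun M' hM' => ?_⟩, fun x hx => ?_⟩
  · rw [hsucc, le_inv_mul_iff₀ hn]
    calc (n : ℝ) * S.successProb M' = ∑ _y : Fin n, S.successProb M' := by simp
      _ ≤ _ := Finset.sum_le_sum fun y _ => (hM y).2 M' hM'
  · rcases smul_eq_zero.mp hx with h0 | h0
    · simp [hnC] at h0
    · have htr : ∑ y, (M y x).trace = 0 := by rw [← Matrix.trace_sum, h0, Matrix.trace_zero]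
      rw [Finset.sum_eq_zero_iff_of_nonneg
        fun y _ => ((hM y).1.posSemidef x).trace_nonneg] at htr
      exact hne x (((hM x).1.posSemidef x).trace_eq_zero_iff.mp (htr x (Finset.mem_univ x)))

/-- The geometry of an optimal measurement that identifies all states: up to a common
translation, the Bloch vectors are a common multiple of the measurement directions. -/
theorem IsOptimal.exists_sub_eq_smul (hS : S.Equiprobable) {v : Fin n → Fin 3 → ℝ}
    (hv : ∀ x, S.state x = blochOp (v x)) (hnt : S.IsNontrivial)
    {a : Fin n → ℝ} {b : Fin n → BlochSpace} (hM : S.IsOptimal fun x => hermOp (a x) (b x))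
    (hle : ∀ x, ‖b x‖ ≤ a x) (ha : ∑ x, a x = 1) (hb : ∑ x, b x = 0)
    (hne : ∀ x, hermOp (a x) (b x) ≠ 0) :
    ∃ F : ℝ, 0 < F ∧ ∀ x y, WithLp.toLp 2 (v x) - WithLp.toLp 2 (v y) =
      F • (‖b x‖⁻¹ • b x - ‖b y‖⁻¹ • b y) := by
  have hn : (0 : ℝ) < 1 / n := one_div_pos.mpr (Nat.cast_pos.mpr S.pos_card)
  set F := ∑ x, inner ℝ (b x) (WithLp.toLp 2 (v x)) with hFdef
  have hF : 0 < F := by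
    have h := hnt.one_div_lt_successProb hS hM
    rw [successProb_hermOp hS hv ha] at h
    nlinarith
  -- Optimality in homogeneous form: dividing `b'` by s = ∑ ‖`b' x`‖ gives a POVM with `a x` = ‖`b
  -- x`‖.
  have hmax : ∀ b' : Fin n → BlochSpace, ∑ x, b' x = 0 →
      ∑ x, inner ℝ (b' x) (WithLp.toLp 2 (v x)) ≤ F * ∑ x, ‖b' x‖ := by
    intro b' hb'
    set s := ∑ x, ‖b' x‖ with hs
    rcases (Finset.sum_nonneg fun x _ => norm_nonneg (b' x) : 0 ≤ s).eq_or_lt with h0 | h0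
    · have hz : ∀ x, b' x = 0 := fun x => norm_eq_zero.mp
        ((Finset.sum_eq_zero_iff_of_nonneg fun x _ => norm_nonneg (b' x)).mp h0.symm x
          (Finset.mem_univ x))
      simp only [hz, inner_zero_left, Finset.sum_const_zero]
      exact mul_nonneg hF.le h0.le
    · have hsum : ∑ x, s⁻¹ * ‖b' x‖ = 1 := by
        rw [← Finset.mul_sum, ← hs, inv_mul_cancel₀ h0.ne']
      have h := hM.2 _ (isPOVM_hermOp (a := fun x => s⁻¹ * ‖b' x‖) (b := fun x => s⁻¹ • b' x)
        (fun x => by rw [norm_smul, Real.norm_of_nonneg (by positivity)]) hsum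
        (by rw [← Finset.smul_sum, hb', smul_zero]))
      rw [successProb_hermOp hS hv hsum, successProb_hermOp hS hv ha] at h
      have h' := (add_le_add_iff_left _).mp (le_of_mul_le_mul_left h hn)
      simp only [real_inner_smul_left] at h'
      rw [← Finset.mul_sum, inv_mul_le_iff₀ h0] at h'
      linarith
  have hlesum : ∑ x, ‖b x‖ ≤ ∑ x, a x := Finset.sum_le_sum fun x _ => hle x
  -- F ≤ F ∑ ‖`b x`‖ with F > 0 forces ∑ ‖`b x`‖ ≥ 1, so every constraint ‖`b x`‖ ≤ `a x` is tight.
  have hsum : ∑ x, ‖b x‖ = ∑ x, a x := by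
    refine le_antisymm hlesum ?_
    have h := hmax b hb
    rw [← hFdef] at h
    rw [ha]
    nlinarith
  have heq : ∀ x, ‖b x‖ = a x := fun x =>
    (Finset.sum_eq_sum_iff_of_le fun x _ => hle x).mp hsum x (Finset.mem_univ x)
  refine ⟨F, hF, sub_eq_smul_of_isMax hmax hF.le hb ?_ fun x hx => hne x ?_⟩
  · rw [hsum, ha, mul_one]
  · rw [← heq x, hx, norm_zero, hermOp_zero]

theorem map_state_eq {v : Fin n → Fin 3 → ℝ} (hv : ∀ x, S.state x = blochOp (v x))
    {N : QubitOp →ₗ[ℂ] QubitOp} (hN : IsChannel N) {D : Matrix (Fin 3) (Fin 3) ℝ}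
    {t : Fin 3 → ℝ} (hD : HasBlochRep N D t) (x : Fin n) :
    (S.map N hN).state x = blochOp (D *ᵥ v x + t) := by
  have h := S.isState x
  rw [hv, blochOp_isState_iff] at h
  change N (S.state x) = _
  rw [hv, hD _ h]

end Ensemble

/-! ### The kernel condition and preservation of optimality -/

theorem kernelCondition_iff {n : ℕ} {D : Matrix (Fin 3) (Fin 3) ℝ} {v : Fin n → Fin 3 → ℝ}
    {κ : ℝ} : KernelCondition D v κ ↔
      κ ∈ Set.Ioc (0 : ℝ) 1 ∧ ∀ x y, D *ᵥ (v x - v y) = κ • (v x - v y) := by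
  simp only [KernelCondition, LinearMap.mem_ker, Matrix.toLin'_apply, Matrix.sub_mulVec,
    Matrix.smul_mulVec, Matrix.one_mulVec, sub_eq_zero]

/-- The antipodal pure states along ±w are sent to ±κ times the unit vector plus t, both in the unit
ball; averaging the squared norms gives κ² + |t|² ≤ 1. -/
theorem IsChannel.le_one_of_mulVec_eq {N : QubitOp →ₗ[ℂ] QubitOp} (hN : IsChannel N)
    {D : Matrix (Fin 3) (Fin 3) ℝ} {t : Fin 3 → ℝ} (hD : HasBlochRep N D t)
    {w : Fin 3 → ℝ} (hw : w ≠ 0) {κ : ℝ} (hκ : D *ᵥ w = κ • w) : κ ≤ 1 := by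
  have hpos : 0 < w ⬝ᵥ w := by
    rw [← star_trivial w]
    exact Matrix.dotProduct_star_self_pos_iff.mpr hw
  have key : ∀ c : ℝ, c ^ 2 * (w ⬝ᵥ w) = 1 → ((c * κ) • w + t) ⬝ᵥ ((c * κ) • w + t) ≤ 1 := by
    intro c hc
    have h1 : (c • w) ⬝ᵥ (c • w) ≤ 1 := by
      simp only [smul_dotProduct, dotProduct_smul, smul_eq_mul]
      linarith
    have h2 := hN.map_isState (blochOp_isState_iff.mpr h1)
    rwa [hD _ h1, blochOp_isState_iff, Matrix.mulVec_smul, hκ, smul_smul] at h2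
  set c := (Real.sqrt (w ⬝ᵥ w))⁻¹ with hc
  have hc1 : c ^ 2 * (w ⬝ᵥ w) = 1 := by
    rw [hc, inv_pow, Real.sq_sqrt hpos.le, inv_mul_cancel₀ hpos.ne']
  have h1 := key c hc1
  have h2 := key (-c) (by rw [neg_sq, hc1])
  have ht : 0 ≤ t ⬝ᵥ t := by simpa using dotProduct_star_self_nonneg t
  simp only [add_dotProduct, dotProduct_add, smul_dotProduct, dotProduct_smul, smul_eq_mul] at h1 h2
  have h3 : κ ^ 2 * (c ^ 2 * (w ⬝ᵥ w)) ≤ 1 := by linarith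
  rw [hc1] at h3
  nlinarith

namespace Ensemble

variable {n : ℕ} {S : Ensemble n} {v : Fin n → Fin 3 → ℝ} {N : QubitOp →ₗ[ℂ] QubitOp}
  {hN : IsChannel N} {D : Matrix (Fin 3) (Fin 3) ℝ} {t : Fin 3 → ℝ} {κ : ℝ}

theorem successProb_map_of_kernelCondition (hS : S.Equiprobable)
    (hv : ∀ x, S.state x = blochOp (v x)) (hD : HasBlochRep N D t) (hκ : KernelCondition D v κ)
    {M : Fin n → QubitOp} (hM : IsPOVM M) :
    (S.map N hN).successProb M = 1 / n + κ * (S.successProb M - 1 / n) := by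
  obtain ⟨a, b, hab, -, ha, hb⟩ := hM.exists_hermOp
  obtain rfl : M = fun x => hermOp (a x) (b x) := funext hab
  let o : Fin n := ⟨0, S.pos_card⟩
  have hdiff := (kernelCondition_iff.mp hκ).2
  rw [successProb_hermOp (S := S.map N hN) hS (map_state_eq hv hN hD) ha,
    successProb_hermOp hS hv ha]
  have hterm : ∀ x, inner ℝ (b x) (WithLp.toLp 2 (D *ᵥ v x + t)) =
      κ * inner ℝ (b x) (WithLp.toLp 2 (v x)) +
        inner ℝ (b x) (WithLp.toLp 2 (D *ᵥ v o + t - κ • v o)) := by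
    intro x
    rw [← real_inner_smul_right, ← inner_add_right, ← WithLp.toLp_smul, ← WithLp.toLp_add]
    congr 2
    have h := hdiff x o
    rw [Matrix.mulVec_sub, smul_sub, sub_eq_iff_eq_add] at h
    rw [h]
    abel
  simp only [hterm]
  rw [Finset.sum_add_distrib, ← Finset.mul_sum, ← sum_inner, hb, inner_zero_left]
  ring

theorem isOptimal_map_iff_of_kernelCondition (hS : S.Equiprobable)
    (hv : ∀ x, S.state x = blochOp (v x)) (hD : HasBlochRep N D t) (hκ : KernelCondition D v κ)
    {M : Fin n → QubitOp} : (S.map N hN).IsOptimal M ↔ S.IsOptimal M := by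
  refine and_congr_right fun hM => forall₂_congr fun M' hM' => ?_
  rw [successProb_map_of_kernelCondition hS hv hD hκ hM,
    successProb_map_of_kernelCondition hS hv hD hκ hM', add_le_add_iff_left,
    mul_le_mul_iff_right₀ hκ.1.1, sub_le_sub_iff_right]

theorem isOMP_of_kernelCondition (hS : S.Equiprobable)
    (hv : ∀ x, S.state x = blochOp (v x)) (hD : HasBlochRep N D t)
    (hκ : KernelCondition D v κ) : S.IsOMP N hN :=
  fun _ hM => ⟨hM, (isOptimal_map_iff_of_kernelCondition hS hv hD hκ).mpr hM⟩

theorem IsNontrivial.map_of_kernelCondition (hnt : S.IsNontrivial) (hS : S.Equiprobable)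
    (hv : ∀ x, S.state x = blochOp (v x)) (hD : HasBlochRep N D t)
    (hκ : KernelCondition D v κ) : (S.map N hN).IsNontrivial :=
  fun j hj => hnt j ((isOptimal_map_iff_of_kernelCondition hS hv hD hκ).mp hj)

theorem Preserves.exists_kernelCondition (hS : S.Equiprobable)
    (hv : ∀ x, S.state x = blochOp (v x)) (hD : HasBlochRep N D t) (hnt : S.IsNontrivial)
    (hnt' : (S.map N hN).IsNontrivial) {M : Fin n → QubitOp} (hM : S.Preserves N hN M)
    (hne : ∀ x, M x ≠ 0) : ∃ κ : ℝ, KernelCondition D v κ := by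
  obtain ⟨hopt, hopt'⟩ := hM
  obtain ⟨a, b, hab, hle, ha, hb⟩ := hopt.1.exists_hermOp
  obtain rfl : M = fun x => hermOp (a x) (b x) := funext hab
  obtain ⟨F, hF, hdiff⟩ := hopt.exists_sub_eq_smul hS hv hnt hle ha hb hne
  obtain ⟨G, hG, hdiff'⟩ := IsOptimal.exists_sub_eq_smul (S := S.map N hN) hS
    (map_state_eq hv hN hD) hnt' hopt' hle ha hb hne
  have hker : ∀ x y, D *ᵥ (v x - v y) = (G / F) • (v x - v y) := by
    intro x y
    apply WithLp.toLp_injective 2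
    have h := hdiff' x y
    rw [← WithLp.toLp_sub, add_sub_add_right_eq_sub, ← Matrix.mulVec_sub] at h
    rw [h, WithLp.toLp_smul, WithLp.toLp_sub, hdiff, smul_smul, div_mul_cancel₀ _ hF.ne']
  refine ⟨G / F, kernelCondition_iff.mpr ⟨⟨div_pos hG hF, ?_⟩, hker⟩⟩
  -- The bound κ ≤ 1 needs a nonzero eigenvector; if all `v x` coincide, every POVM succeeds with
  -- probability 1/n, against nontriviality.
  by_cases hex : ∃ x y, v x ≠ v y
  · obtain ⟨x, y, hxy⟩ := hex
    exact hN.le_one_of_mulVec_eq hD (sub_ne_zero.mpr hxy) (hker x y)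
  · push Not at hex
    have h := hnt.one_div_lt_successProb hS hopt
    let o : Fin n := ⟨0, S.pos_card⟩
    rw [successProb_hermOp hS hv ha] at h
    simp only [hex _ o] at h
    rw [← sum_inner, hb, inner_zero_left] at h
    simp at h

end Ensemble

/-! ### Depolarizing channels and the final assembly -/

theorem depolarizing_apply (η : ℝ) (X : QubitOp) :
    depolarizing η X = ((1 - η : ℝ) : ℂ) • X + (((η / 2 : ℝ) : ℂ) * X.trace) • (1 : QubitOp) := by
  simp only [depolarizing, LinearMap.add_apply, LinearMap.smul_apply, LinearMap.id_apply,
    LinearMap.smulRight_apply, Matrix.traceLinearMap_apply, smul_smul]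

open scoped Kronecker in
theorem isChannel_depolarizing {η : ℝ} (h0 : 0 ≤ η) (h1 : η ≤ 1) :
    IsChannel (depolarizing η) where
  completelyPositive k X hX := by
    -- T is the partial trace of X over the qubit; the extended map sends X to (1 - η) X + (η/2) T ⊗
    -- I.
    let T : Matrix (Fin k) (Fin k) ℂ :=
      ∑ a : Fin 2, X.submatrix (fun p => (p, a)) (fun p => (p, a))
    have hT : T.PosSemidef := Matrix.posSemidef_sum _ fun a _ => hX.submatrix _
    have heq : (Matrix.of fun p q : Fin k × Fin 2 =>
        depolarizing η (Matrix.of fun a b => X (p.1, a) (q.1, b)) p.2 q.2) =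
        ((1 - η : ℝ) : ℂ) • X + ((η / 2 : ℝ) : ℂ) • (T ⊗ₖ (1 : QubitOp)) := by
      ext p q
      simp only [depolarizing_apply, Matrix.of_apply, Matrix.add_apply, Matrix.smul_apply,
        Matrix.kroneckerMap_apply, smul_eq_mul, Matrix.trace_fin_two, T, Fin.sum_univ_two,
        Matrix.submatrix_apply]
      ring
    rw [heq]
    exact (hX.smul (Complex.zero_le_real.mpr (by linarith))).add
      ((hT.kronecker Matrix.PosSemidef.one).smul (Complex.zero_le_real.mpr (by linarith)))
  tracePreserving X := by
    rw [depolarizing_apply, Matrix.trace_add, Matrix.trace_smul, Matrix.trace_smul,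
      Matrix.trace_one]
    simp
    ring

theorem hasBlochRep_depolarizing (η : ℝ) :
    HasBlochRep (depolarizing η) ((1 - η) • (1 : Matrix (Fin 3) (Fin 3) ℝ)) 0 := by
  intro v hv
  rw [depolarizing_apply, (blochOp_isState_iff.mpr hv).trace_eq_one, Matrix.smul_mulVec,
    Matrix.one_mulVec, add_zero, blochOp_eq_hermOp, blochOp_eq_hermOp, hermOp_eq, hermOp_eq]
  ext i j
  fin_cases i <;> fin_cases j <;> simp <;> ring

theorem kernelCondition_smul_one {n : ℕ} {κ : ℝ} (hκ : κ ∈ Set.Ioc (0 : ℝ) 1)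
    (v : Fin n → Fin 3 → ℝ) : KernelCondition (κ • (1 : Matrix (Fin 3) (Fin 3) ℝ)) v κ :=
  kernelCondition_iff.mpr ⟨hκ, fun x y => by rw [Matrix.smul_mulVec, Matrix.one_mulVec]⟩

theorem Ensemble.isOMP_of_hasBlochRep_smul_one {n : ℕ} {S : Ensemble n} (hS : S.Equiprobable)
    {κ : ℝ} {t : Fin 3 → ℝ} {N : QubitOp →ₗ[ℂ] QubitOp} (hN : IsChannel N)
    (hκ : κ ∈ Set.Ioc (0 : ℝ) 1)
    (hD : HasBlochRep N (κ • (1 : Matrix (Fin 3) (Fin 3) ℝ)) t) :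
    S.IsOMP N hN ∧ (S.IsNontrivial → (S.map N hN).IsNontrivial) := by
  obtain ⟨v, hv⟩ := S.exists_blochOp
  have hker := kernelCondition_smul_one hκ v
  exact ⟨isOMP_of_kernelCondition hS hv hD hker,
    fun hnt => hnt.map_of_kernelCondition hS hv hD hker⟩

theorem proposition2 {n : ℕ} (S : Ensemble n) (hS : S.Equiprobable) :
    -- characterization, for a nontrivial problem in which every state is identified
    (S.IsNontrivial → S.AllIdentified →
      ∀ v : Fin n → Fin 3 → ℝ, (∀ x, S.state x = blochOp (v x)) →
      ∀ (N : QubitOp →ₗ[ℂ] QubitOp) (hN : IsChannel N)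
        (D : Matrix (Fin 3) (Fin 3) ℝ) (t : Fin 3 → ℝ), HasBlochRep N D t →
        -- preservation of all optimal measurements
        ((S.IsOMP N hN ∧ (S.map N hN).IsNontrivial) ↔ ∃ κ : ℝ, KernelCondition D v κ) ∧
        -- preservation of one given optimal measurement that identifies all the states
        (∀ M : Fin n → QubitOp, S.IsOptimal M → (∀ x, M x ≠ 0) →
          ((S.Preserves N hN M ∧ (S.map N hN).IsNontrivial) ↔
            ∃ κ : ℝ, KernelCondition D v κ)) ∧
        -- the value of `κ`
        1 / (n : ℝ) < S.guessProb ∧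
        (∀ κ : ℝ, KernelCondition D v κ →
          κ = 1 - S.degradation N hN / (S.guessProb - 1 / (n : ℝ)) ∧
          (S.guessProb = 2 / (n : ℝ) → κ = 1 - n * S.degradation N hN))) ∧
    -- channels of the form `v ↦ κ v + t`
    (∀ (κ : ℝ) (t : Fin 3 → ℝ) (Λ : QubitOp →ₗ[ℂ] QubitOp) (hΛ : IsChannel Λ),
      κ ∈ Set.Ioc (0 : ℝ) 1 → HasBlochRep Λ (κ • (1 : Matrix (Fin 3) (Fin 3) ℝ)) t →
      S.IsOMP Λ hΛ ∧ (S.IsNontrivial → (S.map Λ hΛ).IsNontrivial)) ∧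
    -- depolarizing channels
    (∀ η : ℝ, η ∈ Set.Ico (0 : ℝ) 1 → ∃ hη : IsChannel (depolarizing η),
      HasBlochRep (depolarizing η) ((1 - η) • (1 : Matrix (Fin 3) (Fin 3) ℝ)) 0 ∧
      S.IsOMP (depolarizing η) hη ∧
      (S.IsNontrivial → (S.map (depolarizing η) hη).IsNontrivial)) := by
  refine ⟨fun hnt hall v hv N hN D t hD => ?_, fun κ t Λ hΛ hκ hD =>
    Ensemble.isOMP_of_hasBlochRep_smul_one hS hΛ hκ hD, fun η hη =>
    ⟨isChannel_depolarizing hη.1 hη.2.le, hasBlochRep_depolarizing η,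
      Ensemble.isOMP_of_hasBlochRep_smul_one hS _ ⟨by linarith [hη.2], by linarith [hη.1]⟩
        (hasBlochRep_depolarizing η)⟩⟩
  obtain ⟨M₀, hM₀, hne₀⟩ := hall.exists_isOptimal
  have hlt : 1 / (n : ℝ) < S.guessProb := by
    rw [hM₀.guessProb_eq]
    exact hnt.one_div_lt_successProb hS hM₀
  refine ⟨⟨fun h => (h.1 M₀ hM₀).exists_kernelCondition hS hv hD hnt h.2 hne₀, ?_⟩,
    fun M hM hne => ⟨fun h => h.1.exists_kernelCondition hS hv hD hnt h.2 hne, ?_⟩, hlt, ?_⟩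
  · rintro ⟨κ, hκ⟩
    exact ⟨Ensemble.isOMP_of_kernelCondition hS hv hD hκ,
      hnt.map_of_kernelCondition hS hv hD hκ⟩
  · rintro ⟨κ, hκ⟩
    exact ⟨Ensemble.isOMP_of_kernelCondition hS hv hD hκ M hM,
      hnt.map_of_kernelCondition hS hv hD hκ⟩
  · intro κ hκ
    have hdeg : S.degradation N hN = (1 - κ) * (S.guessProb - 1 / n) := by
      rw [Ensemble.degradation,
        ((Ensemble.isOptimal_map_iff_of_kernelCondition hS hv hD hκ).mpr hM₀).guessProb_eq,
        hM₀.guessProb_eq, Ensemble.successProb_map_of_kernelCondition hS hv hD hκ hM₀.1]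
      ring
    refine ⟨?_, fun h2 => ?_⟩
    · rw [hdeg, mul_div_cancel_right₀ _ (sub_pos.mpr hlt).ne']
      ring
    · have hn : (n : ℝ) ≠ 0 := Nat.cast_ne_zero.mpr S.pos_card.ne'
      rw [hdeg, h2]
      field_simp
      ring
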